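/- **Theorem.** Let $m\ge 0$ and let $(M,g)$ be a smooth Lorentzian manifold of dimension $m+2$ that is geodesically complete (every geodesic extends to a geodesic defined on all of $\mathbb{R}$). Let $\gamma:J\to M$ be an inextendible, affinely parametrized null geodesic, where $J\subseteq\mathbb{R}$ is an open interval. Then the Penrose limit of $(M,g)$ along $\gamma$ is geodesically complete. Here the Penrose limit is defined as follows. An *adapted chart* is a chart $\mu=(u,v,y^1,\dots,y^m)$ on an open subset of $M$ in which $$g=du\,dv+\alpha\,dv^2+\sum_{i}\beta_i\,dy^i\,dv+\sum_{i,j}C_{ij}\,dy^i\,dy^j$$ with $\alpha,\beta_i,C_{ij}$ functions of $(u,v,y)$ and $(C_{ij})$ positive definite, together with an open interval $I\subseteq J$ such that $\mu(\gamma(u))=(u,0,0)$ for $u\in I$. Put $\psi_\Omega(u,v,y)=(u,\Omega^2v,\Omega y)$ for $\Omega>0$. As $\Omega\to0^+$, each point of $I\times\mathbb{R}^{m+1}$ is eventually mapped by $\psi_\Omega$ into the range of $\mu$, and the metrics $\Omega^{-2}\psi_\Omega^*g$ (with $g$ expressed in the chart $\mu$) converge on $I\times\mathbb{R}^{m+1}$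 to $$g_{Pl}=du\,dv+\sum_{i,j}C_{ij}(u,0,0)\,dy^i\,dy^j .$$ A *Penrose limit of $(M,g)$ along $\gamma$* is a smooth Lorentzian manifold $(N,h)$ with a function $u:N\to J$, obtained by choosing an adapted chart $\mu_t$ with interval $I_t\ni t$ for each $t\in J$ and patching the spaces $I_t\times\mathbb{R}^{m+1}$, with their limit metrics, along $\gamma$: for each $t\in J$ there is a chart $\nu_t$ of $N$ with domain $u^{-1}(I_t)$, range $I_t\times\mathbb{R}^{m+1}$ and first coordinate $u$, in which $h=\lim_{\Omega\to0^+}\Omega^{-2}\psi_\Omega^*g$ (with $g$ expressed in $\mu_t$), and the coordinate changes are the limits $\nu_t\circ\nu_s^{-1}=\lim_{\Omega\to0^+}\psi_\Omega^{-1}\circ\mu_t\circ\mu_s^{-1}\circ\psi_\Omega$ on $(I_s\cap I_t)\times\mathbb{R}^{m+1}$. The theorem asserts that every such $(N,h)$ is geodesically complete. -/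

import Mathlib

open scoped Manifold ContDiff Topology Matrix
open Set Filter

/-! ### Lorentzian metrics, geodesics and completeness -/

/-- A smooth Lorentzian metric, of signature `(-, +, …, +)`, on a smooth `d`-manifold. -/
structure LorentzMetric (d : ℕ) (M : Type*) [TopologicalSpace M]
    [ChartedSpace (EuclideanSpace ℝ (Fin d)) M] [IsManifold (𝓡 d) ∞ M] where
  /-- The bilinear form on each tangent space. -/
  form (p : M) : TangentSpace (𝓡 d) p →L[ℝ] TangentSpace (𝓡 d) p →L[ℝ] ℝ
  symm (p : M) (a b : TangentSpace (𝓡 d) p) : form p a b = form p b a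
  /-- Some vector is timelike, and the form is positive definite on its orthogonal complement. -/
  lorentzian (p : M) : ∃ t : TangentSpace (𝓡 d) p, form p t t < 0 ∧
    ∀ w : TangentSpace (𝓡 d) p, form p t w = 0 → w ≠ 0 → 0 < form p w w
  smooth : ContMDiff (𝓡 d)
    ((𝓡 d).prod 𝓘(ℝ, EuclideanSpace ℝ (Fin d) →L[ℝ] EuclideanSpace ℝ (Fin d) →L[ℝ] ℝ)) ∞
    (fun p ↦ Bundle.TotalSpace.mk'
      (EuclideanSpace ℝ (Fin d) →L[ℝ] EuclideanSpace ℝ (Fin d) →L[ℝ] ℝ) p (form p))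

section Geodesics

variable {d : ℕ} {M : Type*} [TopologicalSpace M]
  [ChartedSpace (EuclideanSpace ℝ (Fin d)) M] [IsManifold (𝓡 d) ∞ M]

/-- The metric in the coordinates `e`: the pullback of `g` by `e⁻¹`, at the coordinate
point `x`. -/
noncomputable def LorentzMetric.inChart (g : LorentzMetric d M)
    (e : OpenPartialHomeomorph M (EuclideanSpace ℝ (Fin d))) (x : EuclideanSpace ℝ (Fin d)) :
    EuclideanSpace ℝ (Fin d) →L[ℝ] EuclideanSpace ℝ (Fin d) →L[ℝ] ℝ :=
  let B : EuclideanSpace ℝ (Fin d) →L[ℝ] EuclideanSpace ℝ (Fin d) →L[ℝ] ℝ := g.form (e.symm x)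
  let D : EuclideanSpace ℝ (Fin d) →L[ℝ] EuclideanSpace ℝ (Fin d) :=
    mfderiv (𝓡 d) (𝓡 d) e.symm x
  B.bilinearComp D D

/-- The Christoffel symbols of the first kind of the metric in the coordinates `e`, contracted
with the vectors `a`, `b`, `w`:
`[ab, w] = (∂_a g(b, w) + ∂_b g(a, w) - ∂_w g(a, b)) / 2`. -/
noncomputable def LorentzMetric.christoffel (g : LorentzMetric d M)
    (e : OpenPartialHomeomorph M (EuclideanSpace ℝ (Fin d)))
    (x a b w : EuclideanSpace ℝ (Fin d)) : ℝ :=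
  (fderiv ℝ (g.inChart e) x a b w + fderiv ℝ (g.inChart e) x b a w
    - fderiv ℝ (g.inChart e) x w a b) / 2

/-- `c` is an (affinely parametrized) geodesic of the Levi-Civita connection of `g` on the open
set `J` of parameters: in all smooth local coordinates `x` of the manifold,
`g_{kl} (x^l)'' + [ij, k] (x^i)' (x^j)' = 0` for all `k`. -/
def LorentzMetric.IsGeodesicOn (g : LorentzMetric d M) (c : ℝ → M) (J : Set ℝ) : Prop :=
  ContMDiffOn 𝓘(ℝ, ℝ) (𝓡 d) ∞ c J ∧
  ∀ e ∈ IsManifold.maximalAtlas (𝓡 d) ∞ M, ∀ t ∈ J, c t ∈ e.source →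
    ∀ w : EuclideanSpace ℝ (Fin d),
      g.inChart e (e (c t)) (deriv (deriv fun s ↦ e (c s)) t) w
        + g.christoffel e (e (c t)) (deriv (fun s ↦ e (c s)) t)
            (deriv (fun s ↦ e (c s)) t) w = 0

/-- Geodesic completeness: every geodesic defined on an open interval extends to a geodesic
defined on all of `ℝ`. -/
def LorentzMetric.GeodesicallyComplete (g : LorentzMetric d M) : Prop :=
  ∀ (J : Set ℝ) (c : ℝ → M), IsOpen J → J.OrdConnected → g.IsGeodesicOn c J →
    ∃ c' : ℝ → M, g.IsGeodesicOn c' univ ∧ EqOn c' c J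

/-- `γ`, restricted to the non-empty open interval `J`, is a null geodesic: its velocity is
nowhere zero and has length zero. Moreover it is inextendible as a geodesic. -/
structure LorentzMetric.IsMaximalNullGeodesic (g : LorentzMetric d M) (γ : ℝ → M)
    (J : Set ℝ) : Prop where
  isOpen : IsOpen J
  ordConnected : J.OrdConnected
  nonempty : J.Nonempty
  geodesic : g.IsGeodesicOn γ J
  velocity_ne_zero : ∀ t ∈ J, mfderiv 𝓘(ℝ, ℝ) (𝓡 d) γ t (1 : ℝ) ≠ 0
  null : ∀ t ∈ J, g.form (γ t) (mfderiv 𝓘(ℝ, ℝ) (𝓡 d) γ t (1 : ℝ))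
    (mfderiv 𝓘(ℝ, ℝ) (𝓡 d) γ t (1 : ℝ)) = 0
  maximal : ∀ (J' : Set ℝ) (c : ℝ → M), IsOpen J' → J'.OrdConnected → J ⊆ J' →
    g.IsGeodesicOn c J' → EqOn c γ J → J' = J

end Geodesics

/-! ### Penrose limits

The dimension is `m + 2`; the coordinates `x 0`, `x 1`, `x k.succ.succ` are called
`u`, `v`, `y^k`. -/

/-- The weights `0, 2, 1, …, 1` of the coordinates `u, v, y^1, …, y^m`. -/
def penroseWeight (m : ℕ) : Fin (m + 2) → ℕ :=
  Fin.cons 0 (Fin.cons 2 fun _ ↦ 1)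

/-- The map `ψ_Ω (u, v, y) = (u, Ω² v, Ω y)`. -/
noncomputable def penroseScaling {m : ℕ} (Ω : ℝ) (x : EuclideanSpace ℝ (Fin (m + 2))) :
    EuclideanSpace ℝ (Fin (m + 2)) :=
  WithLp.toLp 2 fun i ↦ Ω ^ penroseWeight m i * x i

section Penrose

variable {m : ℕ} {M : Type*} [TopologicalSpace M]
  [ChartedSpace (EuclideanSpace ℝ (Fin (m + 2))) M] [IsManifold (𝓡 (m + 2)) ∞ M]

/-- Coordinates `(u, v, y)` on an open subset of `M`, adapted to the null geodesic `γ` with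
parameter interval `J`: the metric is
`du dv + α dv² + ∑ β_i dy^i dv + ∑ C_{ij} dy^i dy^j` with `C` positive definite, and
`γ(u) = (u, 0, 0)` for `u` in the open interval `interval`. -/
structure AdaptedChart (g : LorentzMetric (m + 2) M) (γ : ℝ → M) (J : Set ℝ) where
  chart : OpenPartialHomeomorph M (EuclideanSpace ℝ (Fin (m + 2)))
  chart_mem : chart ∈ IsManifold.maximalAtlas (𝓡 (m + 2)) ∞ M
  α : EuclideanSpace ℝ (Fin (m + 2)) → ℝ
  β : EuclideanSpace ℝ (Fin (m + 2)) → Fin m → ℝ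
  C : EuclideanSpace ℝ (Fin (m + 2)) → Matrix (Fin m) (Fin m) ℝ
  C_posDef : ∀ x ∈ chart.target, (C x).PosDef
  metric_eq : ∀ x ∈ chart.target, ∀ a : EuclideanSpace ℝ (Fin (m + 2)),
    g.inChart chart x a a = a 0 * a 1 + α x * a 1 ^ 2
      + ∑ i, β x i * a i.succ.succ * a 1
      + ∑ i, ∑ j, C x i j * a i.succ.succ * a j.succ.succ
  interval : Set ℝ
  interval_isOpen : IsOpen interval
  interval_ordConnected : interval.OrdConnected
  interval_subset : interval ⊆ J
  geodesic_mem : ∀ u ∈ interval, γ u ∈ chart.source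
  geodesic_eq : ∀ u ∈ interval, chart (γ u) = EuclideanSpace.single 0 u

/-- `(N, h)` is the Penrose limit of `(M, g)` along the null geodesic `γ` with parameter
interval `J`.

An adapted chart `μ` whose part of `γ` has the parameters `u ∈ I` gives, for `Ω → 0`, the limit
space `I × ℝ^(m + 1)`, since every point of the latter is eventually mapped into the range of `μ`
by `ψ_Ω`, with the metric `lim Ω⁻² ψ_Ω^* g`. These spaces, for adapted charts around all the
points of `γ`, are patched together along `γ` by the limits `lim ψ_Ω⁻¹ ∘ (μ' ∘ μ⁻¹) ∘ ψ_Ω` of the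
coordinate changes. -/
structure PenroseLimit (g : LorentzMetric (m + 2) M) (γ : ℝ → M) (J : Set ℝ)
    {N : Type*} [TopologicalSpace N] [ChartedSpace (EuclideanSpace ℝ (Fin (m + 2))) N]
    [IsManifold (𝓡 (m + 2)) ∞ N] (h : LorentzMetric (m + 2) N) where
  /-- A choice of an adapted chart around each point of `γ`. -/
  adapted : J → AdaptedChart g γ J
  mem_interval : ∀ t : J, (t : ℝ) ∈ (adapted t).interval
  /-- The function `u` on `N`: the position along `γ`. -/
  u : N → ℝ
  u_mem : ∀ p, u p ∈ J
  /-- The coordinates on `N` that correspond to the adapted charts. -/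
  chart : J → OpenPartialHomeomorph N (EuclideanSpace ℝ (Fin (m + 2)))
  chart_mem : ∀ t, chart t ∈ IsManifold.maximalAtlas (𝓡 (m + 2)) ∞ N
  chart_source : ∀ t, (chart t).source = {p | u p ∈ (adapted t).interval}
  chart_target : ∀ t, (chart t).target = {x | x 0 ∈ (adapted t).interval}
  chart_u : ∀ t, ∀ p ∈ (chart t).source, chart t p 0 = u p
  /-- The coordinate changes of `N` are the limits of the rescaled coordinate changes of `M`. -/
  transition : ∀ s t, ∀ x : EuclideanSpace ℝ (Fin (m + 2)),
    x 0 ∈ (adapted s).interval → x 0 ∈ (adapted t).interval →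
    Tendsto (fun Ω : ℝ ↦ penroseScaling Ω⁻¹
        ((adapted t).chart ((adapted s).chart.symm (penroseScaling Ω x))))
      (𝓝[>] 0) (𝓝 (chart t ((chart s).symm x)))
  /-- The metric of `N` is the limit of the metrics `Ω⁻² ψ_Ω^* g`. -/
  metric_limit : ∀ t, ∀ x : EuclideanSpace ℝ (Fin (m + 2)), x 0 ∈ (adapted t).interval →
    ∀ a b : EuclideanSpace ℝ (Fin (m + 2)),
    Tendsto (fun Ω : ℝ ↦ (Ω ^ 2)⁻¹ * g.inChart (adapted t).chart (penroseScaling Ω x)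
        (penroseScaling Ω a) (penroseScaling Ω b))
      (𝓝[>] 0) (𝓝 (h.inChart (chart t) x a b))

end Penrose

/-! ### Components of the metric in smooth charts. -/

section Coordinates

variable {d : ℕ} {M : Type*} [TopologicalSpace M]
  [ChartedSpace (EuclideanSpace ℝ (Fin d)) M] [IsManifold (𝓡 d) ∞ M]

/-! Completeness of `g` enters only through `γ`: an inextendible geodesic of a complete manifold has
`J = ℝ` (`LorentzMetric.IsMaximalNullGeodesic.eq_univ`).

In each chart the limit metric has Rosen form `du dv + ∑ C_ij(u) dy^i dy^j`, with `C` smooth and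
positive definite (`PenroseLimit.isRosenMetric`). It depends on `u` alone, so its geodesic equations
can be solved by quadrature: `u'' = 0`, the momenta `p_j = ∑ C_ij (y^i)'` are constant, and `v'' = ∑
C_ij'(u) (y^i)' (y^j)'`. Hence `u = a s + b` and `y' = C⁻¹ p`, and a solution exists for as long as
`a s + b` stays in the interval of the chart (`IsRosenMetric.exists_extension`).

The function `u` is global on `N`, so `a` and `b` do not change from chart to chart. At an endpoint
`t` of the domain of a geodesic, the adapted chart at `a t + b ∈ J = ℝ` therefore carries it across
`t`. Zorn's lemma and the connectedness of `ℝ` (`exists_extension_univ`) give a geodesic on `ℝ`. -/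

theorem LorentzMetric.inChart_apply (g : LorentzMetric d M)
    (e : OpenPartialHomeomorph M (EuclideanSpace ℝ (Fin d))) (x a b : EuclideanSpace ℝ (Fin d)) :
    g.inChart e x a b = g.form (e.symm x) (mfderiv (𝓡 d) (𝓡 d) e.symm x a)
      (mfderiv (𝓡 d) (𝓡 d) e.symm x b) := rfl

theorem LorentzMetric.inChart_symm (g : LorentzMetric d M)
    (e : OpenPartialHomeomorph M (EuclideanSpace ℝ (Fin d))) (x a b : EuclideanSpace ℝ (Fin d)) :
    g.inChart e x a b = g.inChart e x b a := by
  rw [g.inChart_apply, g.inChart_apply, g.symm]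

/-- The coordinate vector fields of a smooth chart are smooth. -/
theorem contMDiffOn_mfderiv_symm
    {e : OpenPartialHomeomorph M (EuclideanSpace ℝ (Fin d))}
    (he : e ∈ IsManifold.maximalAtlas (𝓡 d) ∞ M) (a : EuclideanSpace ℝ (Fin d)) :
    ContMDiffOn (𝓡 d) (𝓡 d).tangent ∞ (fun x ↦ Bundle.TotalSpace.mk' (EuclideanSpace ℝ (Fin d))
      (E := fun p : M ↦ TangentSpace (𝓡 d) p) (e.symm x) (mfderiv (𝓡 d) (𝓡 d) e.symm x a))
      e.target := by
  have h1 := contMDiffOn_symm_of_mem_maximalAtlas he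
  have h2 := h1.contMDiffOn_tangentMapWithin (m := ∞) (by simp) e.open_target.uniqueMDiffOn
  have h3 : ContMDiff (𝓡 d) (𝓡 d).tangent ∞ (fun x : EuclideanSpace ℝ (Fin d) ↦
      (⟨x, a⟩ : TangentBundle (𝓡 d) (EuclideanSpace ℝ (Fin d)))) := by
    exact contMDiff_vectorSpace_iff_contDiff.2 contDiff_const
  refine (h2.comp h3.contMDiffOn (s := e.target) (fun x hx ↦ hx)).congr fun x hx ↦ ?_
  simp only [Function.comp, tangentMapWithin]
  rw [mfderivWithin_of_isOpen e.open_target hx]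

/-- Each component is the smooth section `form` evaluated on two smooth coordinate fields. -/
theorem LorentzMetric.contDiffOn_inChart (g : LorentzMetric d M)
    {e : OpenPartialHomeomorph M (EuclideanSpace ℝ (Fin d))}
    (he : e ∈ IsManifold.maximalAtlas (𝓡 d) ∞ M) :
    ContDiffOn ℝ ∞ (g.inChart e) e.target := by
  rw [contDiffOn_clm_apply]
  intro a
  rw [contDiffOn_clm_apply]
  intro b
  rw [← contMDiffOn_iff_contDiffOn]
  have hg : ContMDiffOn (𝓡 d)
      ((𝓡 d).prod 𝓘(ℝ, EuclideanSpace ℝ (Fin d) →L[ℝ] EuclideanSpace ℝ (Fin d) →L[ℝ] ℝ)) ∞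
      (fun x ↦ Bundle.TotalSpace.mk'
        (EuclideanSpace ℝ (Fin d) →L[ℝ] EuclideanSpace ℝ (Fin d) →L[ℝ] ℝ)
        (E := fun p : M ↦ TangentSpace (𝓡 d) p →L[ℝ] TangentSpace (𝓡 d) p →L[ℝ] ℝ)
        (e.symm x) (g.form (e.symm x))) e.target :=
    g.smooth.comp_contMDiffOn (contMDiffOn_symm_of_mem_maximalAtlas he)
  have h := ContMDiffOn.clm_bundle_apply₂ (F₁ := EuclideanSpace ℝ (Fin d))
    (F₂ := EuclideanSpace ℝ (Fin d)) (F₃ := ℝ) (E₃ := fun _ : M ↦ ℝ) hg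
    (contMDiffOn_mfderiv_symm he a)
    (contMDiffOn_mfderiv_symm he b)
  intro x hx
  have h' := h x hx
  simp only [Bundle.contMDiffWithinAt_totalSpace] at h'
  exact h'.2

end Coordinates

/-! ### Covariance of the geodesic equation on vector spaces. -/

section GeodesicEquation

variable {E F : Type*} [NormedAddCommGroup E] [NormedSpace ℝ E]
  [NormedAddCommGroup F] [NormedSpace ℝ F]

/-- The left-hand side of the geodesic equation of the metric `G` on a vector space, for the curve
`x` at time `t`, tested against `w`. -/
noncomputable def geodesicDefect (G : E → E →L[ℝ] E →L[ℝ] ℝ) (x : ℝ → E) (t : ℝ) (w : E) : ℝ :=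
  G (x t) (deriv (deriv x) t) w
    + (fderiv ℝ G (x t) (deriv x t) (deriv x t) w + fderiv ℝ G (x t) (deriv x t) (deriv x t) w
      - fderiv ℝ G (x t) w (deriv x t) (deriv x t)) / 2

theorem geodesicDefect_congr {G : E → E →L[ℝ] E →L[ℝ] ℝ} {x y : ℝ → E} {t : ℝ}
    (h : x =ᶠ[𝓝 t] y) (w : E) : geodesicDefect G x t w = geodesicDefect G y t w := by
  unfold geodesicDefect
  rw [h.deriv.deriv_eq, h.deriv_eq, h.eq_of_nhds]

/-- The product rule. The terms with second derivatives of `φ` are the non-tensorial part of the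
Christoffel symbols; the acceleration of `φ ∘ x` has to account for them. -/
theorem fderiv_pullback_apply {G : E → E →L[ℝ] E →L[ℝ] ℝ} {H : F → F →L[ℝ] F →L[ℝ] ℝ}
    {φ : E → F} {z : E} (hφ : ContDiffAt ℝ ∞ φ z) (hH : DifferentiableAt ℝ H (φ z))
    (hG : ∀ᶠ z' in 𝓝 z, ∀ a b, G z' a b = H (φ z') (fderiv ℝ φ z' a) (fderiv ℝ φ z' b))
    (hGd : DifferentiableAt ℝ G z) (v a b : E) :
    fderiv ℝ G z v a b
      = fderiv ℝ H (φ z) (fderiv ℝ φ z v) (fderiv ℝ φ z a) (fderiv ℝ φ z b)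
        + H (φ z) (fderiv ℝ (fderiv ℝ φ) z v a) (fderiv ℝ φ z b)
        + H (φ z) (fderiv ℝ φ z a) (fderiv ℝ (fderiv ℝ φ) z v b) := by
  have hφ1 : HasFDerivAt φ (fderiv ℝ φ z) z := (hφ.differentiableAt (by simp)).hasFDerivAt
  have hφ2 : HasFDerivAt (fderiv ℝ φ) (fderiv ℝ (fderiv ℝ φ) z) z :=
    ((hφ.fderiv_right (m := ∞) le_rfl).differentiableAt (by simp)).hasFDerivAt
  have hHφ : HasFDerivAt (fun z' ↦ H (φ z')) ((fderiv ℝ H (φ z)).comp (fderiv ℝ φ z)) z :=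
    HasFDerivAt.comp (g := H) (g' := fderiv ℝ H (φ z)) (f := φ) z hH.hasFDerivAt hφ1
  have ha := hφ2.clm_apply (hasFDerivAt_const a z)
  have hb := hφ2.clm_apply (hasFDerivAt_const b z)
  have h1 := (hHφ.clm_apply ha).clm_apply hb
  have h2 := (hGd.hasFDerivAt.clm_apply (hasFDerivAt_const a z)).clm_apply (hasFDerivAt_const b z)
  have h3 := h2.unique (h1.congr_of_eventuallyEq (hG.mono fun z' hz' ↦ hz' a b))
  have h4 := congrArg (fun L : E →L[ℝ] ℝ ↦ L v) h3
  simp at h4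
  rw [h4]
  ring

/-- The geodesic equation is covariant: its left-hand side is a covector. -/
theorem geodesicDefect_pullback {G : E → E →L[ℝ] E →L[ℝ] ℝ} {H : F → F →L[ℝ] F →L[ℝ] ℝ}
    {φ : E → F} {x : ℝ → E} {t : ℝ} (hφ : ContDiffAt ℝ ∞ φ (x t)) (hx : ContDiffAt ℝ ∞ x t)
    (hH : DifferentiableAt ℝ H (φ (x t))) (hsymm : ∀ a b, H (φ (x t)) a b = H (φ (x t)) b a)
    (hG : ∀ᶠ z in 𝓝 (x t), ∀ a b, G z a b = H (φ z) (fderiv ℝ φ z a) (fderiv ℝ φ z b))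
    (hGd : DifferentiableAt ℝ G (x t)) (w : E) :
    geodesicDefect G x t w = geodesicDefect H (φ ∘ x) t (fderiv ℝ φ (x t) w) := by
  have hφ2 : HasFDerivAt (fderiv ℝ φ) (fderiv ℝ (fderiv ℝ φ) (x t)) (x t) :=
    ((hφ.fderiv_right (m := ∞) le_rfl).differentiableAt (by simp)).hasFDerivAt
  have hx1 : HasDerivAt x (deriv x t) t := (hx.differentiableAt (by simp)).hasDerivAt
  have hx2 : HasDerivAt (deriv x) (deriv (deriv x) t) t :=
    ((hx.derivWithin (m := ∞) le_rfl).differentiableAt (by simp)).hasDerivAt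
  have hd : deriv (φ ∘ x) =ᶠ[𝓝 t] fun s ↦ fderiv ℝ φ (x s) (deriv x s) := by
    have e1 : ∀ᶠ s in 𝓝 t, DifferentiableAt ℝ x s :=
      ((hx.of_le (m := 1) (by exact_mod_cast le_top)).eventually (by simp)).mono
        fun s hs ↦ hs.differentiableAt (by simp)
    have e2 : ∀ᶠ s in 𝓝 t, DifferentiableAt ℝ φ (x s) :=
      hx.continuousAt.eventually <|
        ((hφ.of_le (m := 1) (by exact_mod_cast le_top)).eventually (by simp)).mono
        fun s hs ↦ hs.differentiableAt (by simp)
    filter_upwards [e1, e2] with s h1 h2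
    exact (h2.hasFDerivAt.comp_hasDerivAt s h1.hasDerivAt).deriv
  have hd1 := hd.eq_of_nhds
  have hd2 : deriv (deriv (φ ∘ x)) t = fderiv ℝ (fderiv ℝ φ) (x t) (deriv x t) (deriv x t)
      + fderiv ℝ φ (x t) (deriv (deriv x) t) := by
    rw [hd.deriv_eq]
    exact ((hφ2.comp_hasDerivAt t hx1).clm_apply hx2).deriv
  -- With the symmetry of `H`, this cancels the terms in which `w` enters the second derivative; the
  -- remaining one, `D²φ(x', x')`, belongs to `(φ ∘ x)''`.
  have hs : fderiv ℝ (fderiv ℝ φ) (x t) w (deriv x t)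
      = fderiv ℝ (fderiv ℝ φ) (x t) (deriv x t) w :=
    (hφ.isSymmSndFDerivAt (by simpa using ENat.LEInfty.out)) w (deriv x t)
  unfold geodesicDefect
  rw [hd1, hd2, hG.self_of_nhds, fderiv_pullback_apply hφ hH hG hGd,
    fderiv_pullback_apply hφ hH hG hGd, hs, Function.comp_apply, map_add,
    add_apply,
    hsymm (fderiv ℝ (fderiv ℝ φ) (x t) (deriv x t) w)]
  ring

end GeodesicEquation

/-! ### Geodesics on a manifold: independence of the chart, locality. -/

section Geodesics

variable {d : ℕ} {M : Type*} [TopologicalSpace M] [ChartedSpace (EuclideanSpace ℝ (Fin d)) M]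

theorem contDiffAt_coordChange {e e' : OpenPartialHomeomorph M (EuclideanSpace ℝ (Fin d))}
    (he : e ∈ IsManifold.maximalAtlas (𝓡 d) ∞ M) (he' : e' ∈ IsManifold.maximalAtlas (𝓡 d) ∞ M)
    {x : EuclideanSpace ℝ (Fin d)} (hx : x ∈ e.target) (hx' : e.symm x ∈ e'.source) :
    ContDiffAt ℝ ∞ (e' ∘ e.symm) x := by
  rw [← contMDiffAt_iff_contDiffAt]
  exact (contMDiffAt_of_mem_maximalAtlas he' hx').comp x
    (contMDiffAt_symm_of_mem_maximalAtlas he hx)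

theorem contDiffAt_chart_comp {e : OpenPartialHomeomorph M (EuclideanSpace ℝ (Fin d))}
    (he : e ∈ IsManifold.maximalAtlas (𝓡 d) ∞ M) {c : ℝ → M} {t : ℝ}
    (hc : ContMDiffAt 𝓘(ℝ, ℝ) (𝓡 d) ∞ c t) (ht : c t ∈ e.source) :
    ContDiffAt ℝ ∞ (e ∘ c) t := by
  rw [← contMDiffAt_iff_contDiffAt]
  exact (contMDiffAt_of_mem_maximalAtlas he ht).comp t hc

variable [IsManifold (𝓡 d) ∞ M]

theorem LorentzMetric.inChart_coordChange (g : LorentzMetric d M)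
    {e e' : OpenPartialHomeomorph M (EuclideanSpace ℝ (Fin d))}
    (he : e ∈ IsManifold.maximalAtlas (𝓡 d) ∞ M) (he' : e' ∈ IsManifold.maximalAtlas (𝓡 d) ∞ M)
    {x : EuclideanSpace ℝ (Fin d)} (hx : x ∈ e.target) (hx' : e.symm x ∈ e'.source)
    (a b : EuclideanSpace ℝ (Fin d)) :
    g.inChart e x a b = g.inChart e' ((e' ∘ e.symm) x)
      (fderiv ℝ (e' ∘ e.symm) x a) (fderiv ℝ (e' ∘ e.symm) x b) := by
  have hloc : e.symm =ᶠ[𝓝 x] e'.symm ∘ (e' ∘ e.symm) := by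
    have : ∀ᶠ z in 𝓝 x, e.symm z ∈ e'.source :=
      (e.continuousAt_symm hx).eventually (e'.open_source.mem_nhds hx')
    filter_upwards [this] with z hz
    simp [e'.left_inv hz]
  have h1 : MDifferentiableAt (𝓡 d) (𝓡 d) (e' ∘ e.symm) x :=
    (contMDiffAt_iff_contDiffAt.2 (contDiffAt_coordChange he he' hx hx')).mdifferentiableAt
      (by simp)
  have h2 : MDifferentiableAt (𝓡 d) (𝓡 d) e'.symm ((e' ∘ e.symm) x) :=
    (contMDiffAt_symm_of_mem_maximalAtlas he' (e'.map_source hx')).mdifferentiableAt (by simp)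
  have hf : mfderiv (𝓡 d) (𝓡 d) (e' ∘ e.symm) x = fderiv ℝ (e' ∘ e.symm) x := mfderiv_eq_fderiv
  have h3 : mfderiv (𝓡 d) (𝓡 d) e.symm x
      = (mfderiv (𝓡 d) (𝓡 d) e'.symm ((e' ∘ e.symm) x)).comp
        (mfderiv (𝓡 d) (𝓡 d) (e' ∘ e.symm) x) :=
    hloc.mfderiv_eq.trans (mfderiv_comp x h2 h1)
  have h4 : e'.symm ((e' ∘ e.symm) x) = e.symm x := hloc.eq_of_nhds.symm
  -- The type of `g.form p` depends on `p`, so the base point is generalized before it is replaced.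
  have key : ∀ p : M, p = e.symm x → ∀ u v : EuclideanSpace ℝ (Fin d),
      g.form (e.symm x) u v = g.form p u v := by
    rintro p rfl u v; rfl
  rw [g.inChart_apply, g.inChart_apply, h3, ← hf]
  exact key _ h4 _ _

theorem LorentzMetric.isGeodesicOn_iff (g : LorentzMetric d M) (c : ℝ → M) (J : Set ℝ) :
    g.IsGeodesicOn c J ↔ ContMDiffOn 𝓘(ℝ, ℝ) (𝓡 d) ∞ c J ∧
      ∀ e ∈ IsManifold.maximalAtlas (𝓡 d) ∞ M, ∀ t ∈ J, c t ∈ e.source →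
        ∀ w, geodesicDefect (g.inChart e) (e ∘ c) t w = 0 := Iff.rfl

/-- It suffices to check the geodesic equation in one chart around each point. -/
theorem LorentzMetric.isGeodesicOn_of_chart (g : LorentzMetric d M) {c : ℝ → M} {J : Set ℝ}
    (hJ : IsOpen J) (hc : ContMDiffOn 𝓘(ℝ, ℝ) (𝓡 d) ∞ c J)
    (h : ∀ t ∈ J, ∃ e ∈ IsManifold.maximalAtlas (𝓡 d) ∞ M, c t ∈ e.source ∧
      ∀ w, geodesicDefect (g.inChart e) (e ∘ c) t w = 0) :
    g.IsGeodesicOn c J := by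
  refine (g.isGeodesicOn_iff c J).2 ⟨hc, fun e' he' t ht ht' w ↦ ?_⟩
  obtain ⟨e, he, hte, h0⟩ := h t ht
  have hct := hc.contMDiffAt (hJ.mem_nhds ht)
  have hx' := e'.map_source ht'
  have hs : e'.symm (e' (c t)) ∈ e.source := by rwa [e'.left_inv ht']
  have hev : ∀ᶠ z in 𝓝 (e' (c t)), z ∈ e'.target ∧ e'.symm z ∈ e.source :=
    Filter.Eventually.and (e'.open_target.mem_nhds hx')
      ((e'.continuousAt_symm hx').eventually (e.open_source.mem_nhds hs))
  have hd : ∀ {e : OpenPartialHomeomorph M (EuclideanSpace ℝ (Fin d))},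
      e ∈ IsManifold.maximalAtlas (𝓡 d) ∞ M → ∀ {x}, x ∈ e.target →
      DifferentiableAt ℝ (g.inChart e) x := fun he x hx ↦
    ((g.contDiffOn_inChart he).contDiffAt (OpenPartialHomeomorph.open_target _ |>.mem_nhds hx)).differentiableAt
      (by simp)
  have hpull := geodesicDefect_pullback (G := g.inChart e') (H := g.inChart e)
    (φ := e ∘ e'.symm) (x := e' ∘ c) (t := t)
    (contDiffAt_coordChange he' he hx' hs) (contDiffAt_chart_comp he' hct ht')
    (hd he (e.map_source hs)) (fun a b ↦ g.inChart_symm e _ a b)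
    (hev.mono fun z hz a b ↦ g.inChart_coordChange he' he hz.1 hz.2 a b) (hd he' hx') w
  rw [hpull, geodesicDefect_congr (y := e ∘ c), h0]
  have : ∀ᶠ s in 𝓝 t, c s ∈ e'.source :=
    hct.continuousAt.eventually (e'.open_source.mem_nhds ht')
  filter_upwards [this] with s hs
  simp [e'.left_inv hs]

theorem LorentzMetric.IsGeodesicOn.mono {g : LorentzMetric d M} {c : ℝ → M} {J J' : Set ℝ}
    (h : g.IsGeodesicOn c J) (hJ : J' ⊆ J) : g.IsGeodesicOn c J' :=
  ⟨h.1.mono hJ, fun e he t ht ↦ h.2 e he t (hJ ht)⟩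

/-- Smoothness and the geodesic equation depend only on germs of the curve; this permits gluing. -/
theorem LorentzMetric.isGeodesicOn_of_locally {g : LorentzMetric d M} {c : ℝ → M} {J : Set ℝ}
    (h : ∀ t ∈ J, ∃ V, IsOpen V ∧ t ∈ V ∧ ∃ c₁, g.IsGeodesicOn c₁ V ∧ EqOn c c₁ V) :
    g.IsGeodesicOn c J := by
  refine (g.isGeodesicOn_iff c J).2 ⟨fun t ht ↦ ?_, fun e he t ht hte w ↦ ?_⟩
  · obtain ⟨V, hV, htV, c₁, hc₁, heq⟩ := h t ht
    exact ((hc₁.1.contMDiffAt (hV.mem_nhds htV)).congr_of_eventuallyEq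
      (heq.eventuallyEq_of_mem (hV.mem_nhds htV))).contMDiffWithinAt
  · obtain ⟨V, hV, htV, c₁, hc₁, heq⟩ := h t ht
    have hev : e ∘ c =ᶠ[𝓝 t] e ∘ c₁ :=
      (heq.eventuallyEq_of_mem (hV.mem_nhds htV)).fun_comp e
    rw [geodesicDefect_congr hev]
    exact ((g.isGeodesicOn_iff _ _).1 hc₁).2 e he t htV (heq htV ▸ hte) w

theorem LorentzMetric.isGeodesicOn_const (g : LorentzMetric d M) (p : M) (J : Set ℝ) :
    g.IsGeodesicOn (fun _ ↦ p) J := by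
  refine ⟨contMDiffOn_const, fun e he t ht hp w ↦ ?_⟩
  simp [LorentzMetric.christoffel]

end Geodesics

/-! ### Primitives, and smoothness of inverse matrices. -/

section Calculus

/-- A primitive on a smaller interval extends to a primitive on a larger one. -/
theorem exists_primitive_extension {S S' : Set ℝ} (hS : IsOpen S) (hSc : S.OrdConnected)
    (hS' : IsOpen S') (hSc' : S'.OrdConnected) (hne : S'.Nonempty) (hsub : S' ⊆ S)
    {F f : ℝ → ℝ} (hf : ContDiffOn ℝ ∞ f S) (hF : ∀ s ∈ S', HasDerivAt F (f s) s) :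
    ∃ F' : ℝ → ℝ, ContDiffOn ℝ ∞ F' S ∧ EqOn F' F S' ∧ ∀ s ∈ S, HasDerivAt F' (f s) s := by
  obtain ⟨s₀, hs₀⟩ := hne
  have hd : ∀ s ∈ S, HasDerivAt (fun s ↦ F s₀ + ∫ r in s₀..s, f r) (f s) s := by
    intro s hs
    have hsub' : uIcc s₀ s ⊆ S := hSc.uIcc_subset (hsub hs₀) hs
    refine (intervalIntegral.integral_hasDerivAt_right
      (hf.continuousOn.mono hsub').intervalIntegrable
      (hf.continuousOn.stronglyMeasurableAtFilter hS s hs)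
      (hf.continuousOn.continuousAt (hS.mem_nhds hs))).const_add _
  refine ⟨fun s ↦ F s₀ + ∫ r in s₀..s, f r, ?_, ?_, hd⟩
  · rw [contDiffOn_infty_iff_deriv_of_isOpen hS]
    exact ⟨fun s hs ↦ (hd s hs).differentiableAt.differentiableWithinAt,
      hf.congr fun s hs ↦ (hd s hs).deriv⟩
  -- Both are primitives of `f` on the interval `S'` with the same value at `s₀`.
  · refine hS'.eqOn_of_deriv_eq hSc'.isPreconnected
      (fun s hs ↦ (hd s (hsub hs)).differentiableAt.differentiableWithinAt)
      (fun s hs ↦ (hF s hs).differentiableAt.differentiableWithinAt)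
      (fun s hs ↦ by rw [(hd s (hsub hs)).deriv, (hF s hs).deriv]) hs₀ (by simp)

theorem contDiffOn_matrix_det {m : ℕ} {S : Set ℝ} {A : ℝ → Matrix (Fin m) (Fin m) ℝ}
    (hA : ∀ i j, ContDiffOn ℝ ∞ (fun s ↦ A s i j) S) :
    ContDiffOn ℝ ∞ (fun s ↦ (A s).det) S := by
  simp only [Matrix.det_apply']
  exact ContDiffOn.sum fun σ _ ↦ contDiffOn_const.mul (contDiffOn_prod fun i _ ↦ hA _ _)

/-- Cramer's rule: each entry is a determinant with smooth entries, divided by `det A`. -/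
theorem contDiffOn_matrix_inv {m : ℕ} {S : Set ℝ} {A : ℝ → Matrix (Fin m) (Fin m) ℝ}
    (hA : ∀ i j, ContDiffOn ℝ ∞ (fun s ↦ A s i j) S) (h0 : ∀ s ∈ S, (A s).det ≠ 0) (i j : Fin m) :
    ContDiffOn ℝ ∞ (fun s ↦ (A s)⁻¹ i j) S := by
  simp only [Matrix.inv_def, Ring.inverse_eq_inv', Matrix.smul_apply, smul_eq_mul,
    Matrix.adjugate_apply]
  refine ((contDiffOn_matrix_det hA).inv h0).mul (contDiffOn_matrix_det fun k l ↦ ?_)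
  by_cases hk : k = j
  · subst hk
    simpa using contDiffOn_const
  · simpa [Matrix.updateRow_ne hk] using hA k l

theorem hasDerivAt_coord {d : ℕ} {x : ℝ → EuclideanSpace ℝ (Fin d)} {s : ℝ}
    {v : EuclideanSpace ℝ (Fin d)} (h : HasDerivAt x v s) (i : Fin d) :
    HasDerivAt (fun r ↦ x r i) (v i) s := by
  exact (EuclideanSpace.proj (𝕜 := ℝ) i).hasFDerivAt.comp_hasDerivAt s h

theorem hasDerivAt_deriv_of_contDiffOn {E : Type*} [NormedAddCommGroup E] [NormedSpace ℝ E]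
    {x : ℝ → E} {S : Set ℝ} (hS : IsOpen S)
    (hx : ContDiffOn ℝ ∞ x S) {s : ℝ} (hs : s ∈ S) :
    HasDerivAt x (deriv x s) s ∧ HasDerivAt (deriv x) (deriv (deriv x) s) s := by
  have h := hx.contDiffAt (hS.mem_nhds hs)
  exact ⟨(h.differentiableAt (by simp)).hasDerivAt,
    ((h.derivWithin (m := ∞) le_rfl).differentiableAt (by simp)).hasDerivAt⟩

end Calculus

/-! ### Geodesic equations of a metric in Rosen form. -/

section Rosen

variable {m : ℕ}

/-- `H` is the metric `du dv + ∑ C_{ij}(u) dy^i dy^j` at the points with `u ∈ I`. -/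
structure IsRosenMetric (H : EuclideanSpace ℝ (Fin (m + 2)) →
      EuclideanSpace ℝ (Fin (m + 2)) →L[ℝ] EuclideanSpace ℝ (Fin (m + 2)) →L[ℝ] ℝ)
    (C : ℝ → Matrix (Fin m) (Fin m) ℝ) (I : Set ℝ) : Prop where
  isOpen : IsOpen I
  contDiffOn : ∀ i j, ContDiffOn ℝ ∞ (fun u ↦ C u i j) I
  posDef : ∀ u ∈ I, (C u).PosDef
  differentiableAt : ∀ x, x 0 ∈ I → DifferentiableAt ℝ H x
  apply_eq : ∀ x, x 0 ∈ I → ∀ a b, H x a b = (a 0 * b 1 + a 1 * b 0) / 2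
    + ∑ i, ∑ j, C (x 0) i j * a i.succ.succ * b j.succ.succ

variable {H : EuclideanSpace ℝ (Fin (m + 2)) →
      EuclideanSpace ℝ (Fin (m + 2)) →L[ℝ] EuclideanSpace ℝ (Fin (m + 2)) →L[ℝ] ℝ}
    {C : ℝ → Matrix (Fin m) (Fin m) ℝ} {I : Set ℝ}

theorem IsRosenMetric.hasDerivAt (hH : IsRosenMetric H C I) {u : ℝ} (hu : u ∈ I) (i j : Fin m) :
    HasDerivAt (fun u ↦ C u i j) (deriv (fun u ↦ C u i j) u) u :=
  (((hH.contDiffOn i j).contDiffAt (hH.isOpen.mem_nhds hu)).differentiableAt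
    (by simp)).hasDerivAt

theorem IsRosenMetric.fderiv_apply (hH : IsRosenMetric H C I)
    {x : EuclideanSpace ℝ (Fin (m + 2))} (hx : x 0 ∈ I) (v a b : EuclideanSpace ℝ (Fin (m + 2))) :
    fderiv ℝ H x v a b = v 0 * ∑ i, ∑ j, deriv (fun u ↦ C u i j) (x 0) * a i.succ.succ
      * b j.succ.succ := by
  have h0 : HasFDerivAt (fun z : EuclideanSpace ℝ (Fin (m + 2)) ↦ z 0)
      (EuclideanSpace.proj (𝕜 := ℝ) (0 : Fin (m + 2))) x :=
    (EuclideanSpace.proj (𝕜 := ℝ) (0 : Fin (m + 2))).hasFDerivAt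
  have h1 := (((hH.differentiableAt x hx).hasFDerivAt.clm_apply
    (hasFDerivAt_const a x)).clm_apply (hasFDerivAt_const b x))
  have h2 : HasFDerivAt (fun z : EuclideanSpace ℝ (Fin (m + 2)) ↦ (a 0 * b 1 + a 1 * b 0) / 2
      + ∑ i, ∑ j, C (z 0) i j * (a i.succ.succ * b j.succ.succ)) _ x :=
    (HasFDerivAt.fun_sum fun i _ ↦ HasFDerivAt.fun_sum fun j _ ↦
      ((hH.hasDerivAt hx i j).comp_hasFDerivAt x h0).mul_const
        (a i.succ.succ * b j.succ.succ)).const_add _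
  have hev : (fun z ↦ H z a b) =ᶠ[𝓝 x] fun z ↦ (a 0 * b 1 + a 1 * b 0) / 2
      + ∑ i, ∑ j, C (z 0) i j * (a i.succ.succ * b j.succ.succ) := by
    filter_upwards [h0.continuousAt.eventually (hH.isOpen.mem_nhds hx)] with z hz
    simp only [hH.apply_eq z hz, mul_assoc]
  have h3 := congrArg (fun L : EuclideanSpace ℝ (Fin (m + 2)) →L[ℝ] ℝ ↦ L v)
    (h1.unique (h2.congr_of_eventuallyEq hev))
  simp at h3
  rw [h3, Finset.mul_sum]
  refine Finset.sum_congr rfl fun i _ ↦ ?_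
  rw [Finset.mul_sum]
  refine Finset.sum_congr rfl fun j _ ↦ ?_
  ring

/-- The geodesic equation of the metric `du dv + ∑ C_{ij}(u) dy^i dy^j`. -/
theorem IsRosenMetric.geodesicDefect_eq_zero_iff (hH : IsRosenMetric H C I)
    {x : ℝ → EuclideanSpace ℝ (Fin (m + 2))} {t : ℝ} (hx : x t 0 ∈ I) :
    (∀ w, geodesicDefect H x t w = 0) ↔
      deriv (deriv x) t 0 = 0 ∧
      deriv (deriv x) t 1 = ∑ i, ∑ j, deriv (fun u ↦ C u i j) (x t 0) *
        deriv x t i.succ.succ * deriv x t j.succ.succ ∧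
      ∀ j : Fin m, ∑ i, (C (x t 0) i j * deriv (deriv x) t i.succ.succ
        + deriv x t 0 * deriv (fun u ↦ C u i j) (x t 0) * deriv x t i.succ.succ) = 0 := by
  set A := deriv (deriv x) t
  set V := deriv x t
  -- The defect is linear in `w`, and its coefficients are the three equations. As the metric pairs
  -- `u` with `v`, the equation for `u''` belongs to `w 1` and that for `v''` to `w 0`.
  have key : ∀ w, geodesicDefect H x t w = A 0 * w 1 / 2
      + w 0 / 2 * (A 1 - ∑ i, ∑ j, deriv (fun u ↦ C u i j) (x t 0) *
        V i.succ.succ * V j.succ.succ)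
      + ∑ j : Fin m, w j.succ.succ * ∑ i, (C (x t 0) i j * A i.succ.succ
        + V 0 * deriv (fun u ↦ C u i j) (x t 0) * V i.succ.succ) := by
    intro w
    have e1 : ∑ j : Fin m, w j.succ.succ * ∑ i, (C (x t 0) i j * A i.succ.succ
        + V 0 * deriv (fun u ↦ C u i j) (x t 0) * V i.succ.succ)
        = ∑ i, ∑ j, C (x t 0) i j * A i.succ.succ * w j.succ.succ
          + V 0 * ∑ i, ∑ j, deriv (fun u ↦ C u i j) (x t 0) * V i.succ.succ * w j.succ.succ := by
      simp only [Finset.mul_sum]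
      rw [Finset.sum_comm, ← Finset.sum_add_distrib]
      refine Finset.sum_congr rfl fun i _ ↦ ?_
      rw [← Finset.sum_add_distrib]
      refine Finset.sum_congr rfl fun j _ ↦ ?_
      ring
    rw [e1, geodesicDefect, hH.apply_eq _ hx, hH.fderiv_apply hx, hH.fderiv_apply hx]
    ring
  constructor
  · intro h
    refine ⟨?_, ?_, fun j ↦ ?_⟩
    · have := h (EuclideanSpace.single 1 1)
      rw [key] at this
      simpa [Fin.ext_iff] using this
    · have := h (EuclideanSpace.single 0 1)
      rw [key] at this
      simp [Fin.ext_iff] at this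
      linarith
    · have := h (EuclideanSpace.single j.succ.succ 1)
      rw [key] at this
      have n0 : (0 : Fin (m + 2)) ≠ j.succ.succ := by simp [Fin.ext_iff]
      have n1 : (1 : Fin (m + 2)) ≠ j.succ.succ := by simp [Fin.ext_iff]
      simpa [n0, n1, Pi.single_apply] using this
  · rintro ⟨h0, h1, h2⟩ w
    rw [key, h0, h1]
    simp [h2]

end Rosen

/-! ### Solving the Rosen geodesic equations by quadrature. -/

section RosenExtension

variable {m : ℕ}
  {H : EuclideanSpace ℝ (Fin (m + 2)) →
      EuclideanSpace ℝ (Fin (m + 2)) →L[ℝ] EuclideanSpace ℝ (Fin (m + 2)) →L[ℝ] ℝ}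
  {C : ℝ → Matrix (Fin m) (Fin m) ℝ} {I : Set ℝ}

theorem hasDerivAt_affine (a b s : ℝ) : HasDerivAt (fun s ↦ a * s + b) a s := by
  simpa using ((hasDerivAt_id s).const_mul a).add_const b

/-- A geodesic of `du dv + ∑ C_{ij}(u) dy^i dy^j` extends as long as its affine `u`-coordinate
stays in the domain `I` of `C`. -/
theorem IsRosenMetric.exists_extension (hH : IsRosenMetric H C I) {S S' : Set ℝ}
    (hS : IsOpen S) (hSc : S.OrdConnected) (hS' : IsOpen S') (hSc' : S'.OrdConnected)
    (hne : S'.Nonempty) (hsub : S' ⊆ S) {a b : ℝ} (hI : ∀ s ∈ S, a * s + b ∈ I)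
    {x : ℝ → EuclideanSpace ℝ (Fin (m + 2))} (hx : ContDiffOn ℝ ∞ x S')
    (hx0 : ∀ s ∈ S', x s 0 = a * s + b)
    (hgeo : ∀ s ∈ S', ∀ w, geodesicDefect H x s w = 0) :
    ∃ x' : ℝ → EuclideanSpace ℝ (Fin (m + 2)), ContDiffOn ℝ ∞ x' S ∧ EqOn x' x S' ∧
      (∀ s ∈ S, x' s 0 = a * s + b) ∧ ∀ s ∈ S, ∀ w, geodesicDefect H x' s w = 0 := by
  have hU : ContDiff ℝ ∞ (fun s : ℝ ↦ a * s + b) := by fun_prop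
  have hC : ∀ i j, ContDiffOn ℝ ∞ (fun s ↦ C (a * s + b) i j) S := fun i j ↦
    (hH.contDiffOn i j).comp hU.contDiffOn hI
  have hC' : ∀ i j, ContDiffOn ℝ ∞ (fun s ↦ deriv (fun u ↦ C u i j) (a * s + b)) S := fun i j ↦
    ((contDiffOn_infty_iff_deriv_of_isOpen hH.isOpen).1 (hH.contDiffOn i j)).2.comp
      hU.contDiffOn hI
  have hCd : ∀ s ∈ S, ∀ i j, HasDerivAt (fun s ↦ C (a * s + b) i j)
      (a * deriv (fun u ↦ C u i j) (a * s + b)) s := by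
    intro s hs i j
    have := (hH.hasDerivAt (hI s hs) i j).comp s (hasDerivAt_affine a b s)
    rwa [mul_comm] at this
  have hxd := fun s (hs : s ∈ S') ↦ hasDerivAt_deriv_of_contDiffOn hS' hx hs
  have hx0d : ∀ s ∈ S', deriv x s 0 = a := fun s hs ↦
    (hasDerivAt_coord (hxd s hs).1 0).unique <|
      (hasDerivAt_affine a b s).congr_of_eventuallyEq
        (Filter.eventuallyEq_of_mem (hS'.mem_nhds hs) hx0)
  have heq : ∀ s ∈ S', _ := fun s hs ↦
    (hH.geodesicDefect_eq_zero_iff (x := x) (t := s)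
      (by rw [hx0 s hs]; exact hI s (hsub hs))).1 (hgeo s hs)
  -- conserved momenta
  obtain ⟨s₀, hs₀⟩ := hne
  let p : ℝ → Fin m → ℝ := fun s j ↦ ∑ i, C (a * s + b) i j * deriv x s i.succ.succ
  have hp : ∀ s ∈ S', p s = p s₀ := by
    intro s hs
    funext j
    have hd : ∀ r ∈ S', HasDerivAt (fun r ↦ p r j) 0 r := by
      intro r hr
      have h2 := (heq r hr).2.2 j
      rw [hx0d r hr, hx0 r hr] at h2
      rw [← h2]
      refine HasDerivAt.fun_sum fun i _ ↦ ?_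
      have := (hCd r (hsub hr) i j).mul (hasDerivAt_coord (hxd r hr).2 i.succ.succ)
      exact this.congr_deriv (add_comm _ _)
    exact hS'.is_const_of_deriv_eq_zero hSc'.isPreconnected
      (fun r hr ↦ (hd r hr).differentiableAt.differentiableWithinAt)
      (fun r hr ↦ (hd r hr).deriv) hs hs₀
  have hunit : ∀ s ∈ S, IsUnit (C (a * s + b)).det := fun s hs ↦
    (hH.posDef _ (hI s hs)).det_pos.ne'.isUnit
  -- The velocity `y' = C⁻¹ p` forced by the conserved momenta; unlike `deriv x`, it makes sense on
  -- all of `S`.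
  let f : ℝ → Fin m → ℝ := fun s ↦ p s₀ ᵥ* (C (a * s + b))⁻¹
  have hf : ∀ i, ContDiffOn ℝ ∞ (fun s ↦ f s i) S := fun i ↦ by
    simp only [f, Matrix.vecMul, dotProduct]
    exact ContDiffOn.sum fun j _ ↦ contDiffOn_const.mul
      (contDiffOn_matrix_inv hC (fun s hs ↦ (hunit s hs).ne_zero) j i)
  have hfp : ∀ s ∈ S, ∀ j, ∑ i, C (a * s + b) i j * f s i = p s₀ j := by
    intro s hs j
    have : f s ᵥ* C (a * s + b) = p s₀ := by
      rw [Matrix.vecMul_vecMul, Matrix.nonsing_inv_mul _ (hunit s hs), Matrix.vecMul_one]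
    rw [← this]
    simp [Matrix.vecMul, dotProduct, mul_comm]
  have hxf : ∀ s ∈ S', ∀ i : Fin m, deriv x s i.succ.succ = f s i := by
    intro s hs i
    have h1 : (fun i : Fin m ↦ deriv x s i.succ.succ) ᵥ* C (a * s + b) = p s₀ := by
      rw [← hp s hs]
      funext j
      simp [p, Matrix.vecMul, dotProduct, mul_comm]
    have h2 : (fun i : Fin m ↦ deriv x s i.succ.succ) = f s := by
      simp only [f]
      rw [← h1, Matrix.vecMul_vecMul, Matrix.mul_nonsing_inv _ (hunit s (hsub hs)),
        Matrix.vecMul_one]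
    exact congrFun h2 i
  choose y hyc hye hyd using fun i : Fin m ↦ exists_primitive_extension hS hSc hS' hSc'
    ⟨s₀, hs₀⟩ hsub (F := fun s ↦ x s i.succ.succ) (hf i)
    (fun s hs ↦ hxf s hs i ▸ hasDerivAt_coord (hxd s hs).1 i.succ.succ)
  -- The prescribed `v''`, integrated twice: `w` is `v'`, then `v` itself.
  let q : ℝ → ℝ := fun s ↦ ∑ i, ∑ j, deriv (fun u ↦ C u i j) (a * s + b) * f s i * f s j
  have hq : ContDiffOn ℝ ∞ q S := ContDiffOn.sum fun i _ ↦ ContDiffOn.sum fun j _ ↦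
    ((hC' i j).mul (hf i)).mul (hf j)
  obtain ⟨w, hwc, hwe, hwd⟩ := exists_primitive_extension hS hSc hS' hSc' ⟨s₀, hs₀⟩ hsub
    (F := fun s ↦ deriv x s 1) hq (fun s hs ↦ by
      have h2 := (heq s hs).2.1
      simp only [hxf s hs, hx0 s hs] at h2
      exact (hasDerivAt_coord (hxd s hs).2 1).congr_deriv h2)
  obtain ⟨v, hvc, hve, hvd⟩ := exists_primitive_extension hS hSc hS' hSc' ⟨s₀, hs₀⟩ hsub
    (F := fun s ↦ x s 1) hwc (fun s hs ↦ hwe hs ▸ hasDerivAt_coord (hxd s hs).1 1)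
  let x' : ℝ → EuclideanSpace ℝ (Fin (m + 2)) := fun s ↦
    WithLp.toLp 2 (Fin.cons (a * s + b) (Fin.cons (v s) fun i ↦ y i s) : Fin (m + 2) → ℝ)
  have hx'c : ContDiffOn ℝ ∞ x' S := by
    rw [contDiffOn_euclidean]
    intro i
    refine Fin.cases ?_ (fun i ↦ Fin.cases ?_ (fun i ↦ ?_) i) i
    · exact hU.contDiffOn
    · exact hvc
    · exact hyc i
  refine ⟨x', hx'c, ?_, fun s hs ↦ rfl, fun s hs ↦ ?_⟩
  · intro s hs
    ext i
    refine Fin.cases ?_ (fun i ↦ Fin.cases ?_ (fun i ↦ ?_) i) i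
    · exact (hx0 s hs).symm
    · exact hve hs
    · exact hye i hs
  have hd := fun r (hr : r ∈ S) ↦ hasDerivAt_deriv_of_contDiffOn hS hx'c hr
  have d0 : ∀ r ∈ S, deriv x' r 0 = a := fun r hr ↦
    (hasDerivAt_coord (hd r hr).1 0).unique (hasDerivAt_affine a b r)
  have d1 : ∀ r ∈ S, deriv x' r 1 = w r := fun r hr ↦
    (hasDerivAt_coord (hd r hr).1 1).unique (hvd r hr)
  have d2 : ∀ r ∈ S, ∀ i : Fin m, deriv x' r i.succ.succ = f r i := fun r hr i ↦
    (hasDerivAt_coord (hd r hr).1 i.succ.succ).unique (hyd i r hr)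
  have hSs := hS.mem_nhds hs
  rw [hH.geodesicDefect_eq_zero_iff (hI s hs)]
  refine ⟨?_, ?_, fun j ↦ ?_⟩
  · exact (hasDerivAt_coord (hd s hs).2 0).unique
      ((hasDerivAt_const s a).congr_of_eventuallyEq (Filter.eventuallyEq_of_mem hSs d0))
  · simp only [d2 s hs]
    exact (hasDerivAt_coord (hd s hs).2 1).unique
      ((hwd s hs).congr_of_eventuallyEq (Filter.eventuallyEq_of_mem hSs d1))
  -- The equation for `y` is the vanishing of the derivative of the momentum, which is constant by
  -- the choice of `f`.
  · have h1 : HasDerivAt (fun r ↦ ∑ i, C (a * r + b) i j * deriv x' r i.succ.succ) 0 s :=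
      (hasDerivAt_const s (p s₀ j)).congr_of_eventuallyEq
        (Filter.eventuallyEq_of_mem hSs fun r hr ↦ by simp only [d2 r hr, hfp r hr])
    have h2 : HasDerivAt (fun r ↦ ∑ i, C (a * r + b) i j * deriv x' r i.succ.succ) _ s :=
      HasDerivAt.fun_sum fun i _ ↦
        (hCd s hs i j).mul (hasDerivAt_coord (hd s hs).2 i.succ.succ)
    rw [← h2.unique h1, d0 s hs]
    exact Finset.sum_congr rfl fun i _ ↦ add_comm _ _

end RosenExtension

/-! ### The limit metric has Rosen form. -/

section PenroseMetric

variable {m : ℕ} {M : Type*} [TopologicalSpace M]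
  [ChartedSpace (EuclideanSpace ℝ (Fin (m + 2))) M] [IsManifold (𝓡 (m + 2)) ∞ M]
  {g : LorentzMetric (m + 2) M} {γ : ℝ → M} {J : Set ℝ}

theorem AdaptedChart.single_mem_target (A : AdaptedChart g γ J) {u : ℝ} (hu : u ∈ A.interval) :
    EuclideanSpace.single 0 u ∈ A.chart.target := by
  rw [← A.geodesic_eq u hu]
  exact A.chart.map_source (A.geodesic_mem u hu)

/-- A vector `(a_u, a_v, a_y)` with its first two components set to `0`. -/
noncomputable def transversePart (a : EuclideanSpace ℝ (Fin (m + 2))) :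
    EuclideanSpace ℝ (Fin (m + 2)) :=
  WithLp.toLp 2 (Fin.cons 0 (Fin.cons 0 fun i ↦ a i.succ.succ) : Fin (m + 2) → ℝ)

/-- A vector `(a_u, a_v, a_y)` with its first component set to `0`. -/
noncomputable def truncation (a : EuclideanSpace ℝ (Fin (m + 2))) :
    EuclideanSpace ℝ (Fin (m + 2)) :=
  WithLp.toLp 2 (Fin.cons 0 (Fin.cons (a 1) fun i ↦ a i.succ.succ) : Fin (m + 2) → ℝ)

theorem transversePart_zero_coord (a : EuclideanSpace ℝ (Fin (m + 2))) :
    transversePart a 0 = 0 := rfl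

theorem transversePart_one_coord (a : EuclideanSpace ℝ (Fin (m + 2))) :
    transversePart a 1 = 0 := rfl

theorem transversePart_succ_succ_coord (a : EuclideanSpace ℝ (Fin (m + 2))) (i : Fin m) :
    transversePart a i.succ.succ = a i.succ.succ := rfl

theorem truncation_zero_coord (a : EuclideanSpace ℝ (Fin (m + 2))) :
    truncation a 0 = 0 := rfl

theorem truncation_one_coord (a : EuclideanSpace ℝ (Fin (m + 2))) :
    truncation a 1 = a 1 := rfl

theorem truncation_succ_succ_coord (a : EuclideanSpace ℝ (Fin (m + 2))) (i : Fin m) :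
    truncation a i.succ.succ = a i.succ.succ := rfl

theorem penroseScaling_zero_coord (Ω : ℝ) (x : EuclideanSpace ℝ (Fin (m + 2))) :
    penroseScaling Ω x 0 = x 0 := by simp [penroseScaling, penroseWeight]

theorem penroseScaling_one_coord (Ω : ℝ) (x : EuclideanSpace ℝ (Fin (m + 2))) :
    penroseScaling Ω x 1 = Ω ^ 2 * x 1 := rfl

theorem penroseScaling_succ_succ_coord (Ω : ℝ) (x : EuclideanSpace ℝ (Fin (m + 2)))
    (i : Fin m) : penroseScaling Ω x i.succ.succ = Ω * x i.succ.succ := by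
  simp [penroseScaling, penroseWeight]

/-- The scaling collapses the chart onto `γ` and fixes `u`; this is why only `C(u, 0, 0)` survives
in the limit. -/
theorem tendsto_penroseScaling (x : EuclideanSpace ℝ (Fin (m + 2))) :
    Tendsto (fun Ω : ℝ ↦ penroseScaling Ω x) (𝓝[>] 0) (𝓝 (EuclideanSpace.single 0 (x 0))) := by
  have hc : Continuous fun Ω : ℝ ↦ penroseScaling Ω x := by
    unfold penroseScaling
    fun_prop
  have h0 : penroseScaling 0 x = EuclideanSpace.single 0 (x 0) := by
    ext i
    refine Fin.cases ?_ (fun i ↦ Fin.cases ?_ (fun i ↦ ?_) i) i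
    · simp [penroseScaling_zero_coord]
    · simp [penroseScaling_one_coord]
    · simp [penroseScaling_succ_succ_coord, Fin.ext_iff]
  rw [← h0]
  exact hc.continuousAt.tendsto.mono_left nhdsWithin_le_nhds

/-- The rescaled metric in an adapted chart, in terms of continuous coefficients. -/
theorem AdaptedChart.rescaled_apply (A : AdaptedChart g γ J) {z : EuclideanSpace ℝ (Fin (m + 2))}
    (hz : z ∈ A.chart.target) {Ω : ℝ} (hΩ : 0 < Ω) (a : EuclideanSpace ℝ (Fin (m + 2))) :
    (Ω ^ 2)⁻¹ * g.inChart A.chart z (penroseScaling Ω a) (penroseScaling Ω a)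
      = a 0 * a 1 + Ω ^ 2 * a 1 ^ 2
          * g.inChart A.chart z (EuclideanSpace.single 1 1) (EuclideanSpace.single 1 1)
        + Ω * (g.inChart A.chart z (truncation a) (truncation a)
          - a 1 ^ 2 * g.inChart A.chart z (EuclideanSpace.single 1 1) (EuclideanSpace.single 1 1)
          - g.inChart A.chart z (transversePart a) (transversePart a))
        + g.inChart A.chart z (transversePart a) (transversePart a) := by
  -- No continuity is postulated for `α`, `β`, `C`. They are expressed through the smooth
  -- `g.inChart`: `α` by `∂_v`, the `C`-term by the transverse part, the `β`-term as the remainder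
  -- for the truncated vector.
  have h1 : g.inChart A.chart z (EuclideanSpace.single 1 1) (EuclideanSpace.single 1 1)
      = A.α z := by
    rw [A.metric_eq z hz]
    simp [Fin.ext_iff]
  have h2 : g.inChart A.chart z (transversePart a) (transversePart a)
      = ∑ i, ∑ j, A.C z i j * a i.succ.succ * a j.succ.succ := by
    rw [A.metric_eq z hz]
    simp [transversePart_zero_coord, transversePart_one_coord, transversePart_succ_succ_coord]
  have h3 : g.inChart A.chart z (truncation a) (truncation a)
      = A.α z * a 1 ^ 2 + ∑ i, A.β z i * a i.succ.succ * a 1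
        + ∑ i, ∑ j, A.C z i j * a i.succ.succ * a j.succ.succ := by
    rw [A.metric_eq z hz]
    simp [truncation_zero_coord, truncation_one_coord, truncation_succ_succ_coord]
  have h4 : ∑ i, A.β z i * (Ω * a i.succ.succ) * (Ω ^ 2 * a 1)
      = Ω ^ 3 * ∑ i, A.β z i * a i.succ.succ * a 1 := by
    rw [Finset.mul_sum]
    exact Finset.sum_congr rfl fun i _ ↦ by ring
  have h5 : ∑ i, ∑ j, A.C z i j * (Ω * a i.succ.succ) * (Ω * a j.succ.succ)
      = Ω ^ 2 * ∑ i, ∑ j, A.C z i j * a i.succ.succ * a j.succ.succ := by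
    simp only [Finset.mul_sum]
    exact Finset.sum_congr rfl fun i _ ↦ Finset.sum_congr rfl fun j _ ↦ by ring
  rw [h1, h2, h3, A.metric_eq z hz]
  simp only [penroseScaling_zero_coord, penroseScaling_one_coord, penroseScaling_succ_succ_coord,
    h4, h5]
  field_simp
  ring

variable {N : Type*} [TopologicalSpace N] [ChartedSpace (EuclideanSpace ℝ (Fin (m + 2))) N]
  [IsManifold (𝓡 (m + 2)) ∞ N] {h : LorentzMetric (m + 2) N}

/-- The `α`- and `β`-terms carry factors `Ω²` and `Ω`, so they vanish in the limit; uniqueness of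
limits identifies `h`. -/
theorem PenroseLimit.inChart_self (P : PenroseLimit g γ J h) (t : J)
    {x : EuclideanSpace ℝ (Fin (m + 2))} (hx : x 0 ∈ (P.adapted t).interval)
    (a : EuclideanSpace ℝ (Fin (m + 2))) :
    h.inChart (P.chart t) x a a = a 0 * a 1
      + ∑ i, ∑ j, (P.adapted t).C (EuclideanSpace.single 0 (x 0)) i j
        * a i.succ.succ * a j.succ.succ := by
  set A := P.adapted t
  have hmem := A.single_mem_target hx
  have hcont : ContinuousAt (g.inChart A.chart) (EuclideanSpace.single 0 (x 0)) :=
    (g.contDiffOn_inChart A.chart_mem).continuousOn.continuousAt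
      (A.chart.open_target.mem_nhds hmem)
  have hlim : ∀ b : EuclideanSpace ℝ (Fin (m + 2)),
      Tendsto (fun Ω : ℝ ↦ g.inChart A.chart (penroseScaling Ω x) b b) (𝓝[>] 0)
        (𝓝 (g.inChart A.chart (EuclideanSpace.single 0 (x 0)) b b)) := fun b ↦
    Tendsto.comp (((hcont.clm_apply continuousAt_const).clm_apply continuousAt_const))
      (tendsto_penroseScaling x)
  have hΩ : Tendsto (fun Ω : ℝ ↦ Ω) (𝓝[>] 0) (𝓝 0) := nhdsWithin_le_nhds
  have h1 := hlim (EuclideanSpace.single 1 1)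
  have h2 := hlim (truncation a)
  have h3 := hlim (transversePart a)
  have hT := ((((hΩ.pow 2).mul_const (a 1 ^ 2)).mul h1).const_add (a 0 * a 1)).add
    (hΩ.mul ((h2.sub (h1.const_mul (a 1 ^ 2))).sub h3)) |>.add h3
  have hev : ∀ᶠ Ω : ℝ in 𝓝[>] 0, penroseScaling Ω x ∈ A.chart.target :=
    (tendsto_penroseScaling x).eventually (A.chart.open_target.mem_nhds hmem)
  have hT' := hT.congr' (f₂ := fun Ω ↦ (Ω ^ 2)⁻¹ * g.inChart A.chart (penroseScaling Ω x)
      (penroseScaling Ω a) (penroseScaling Ω a)) (by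
    filter_upwards [hev, self_mem_nhdsWithin] with Ω hz hpos
    exact (A.rescaled_apply hz hpos a).symm)
  rw [tendsto_nhds_unique (P.metric_limit t x hx a a) hT', A.metric_eq _ hmem (transversePart a)]
  simp [transversePart_zero_coord, transversePart_one_coord, transversePart_succ_succ_coord]

theorem PenroseLimit.isRosenMetric (P : PenroseLimit g γ J h) (t : J) :
    IsRosenMetric (h.inChart (P.chart t))
      (fun u ↦ (P.adapted t).C (EuclideanSpace.single 0 u)) (P.adapted t).interval := by
  set A := P.adapted t
  have hpos : ∀ u ∈ A.interval, (A.C (EuclideanSpace.single 0 u)).PosDef := fun u hu ↦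
    A.C_posDef _ (A.single_mem_target hu)
  -- Polarization of `PenroseLimit.inChart_self`, by the symmetry of `C`.
  have happ : ∀ x : EuclideanSpace ℝ (Fin (m + 2)), x 0 ∈ A.interval → ∀ a b,
      h.inChart (P.chart t) x a b = (a 0 * b 1 + a 1 * b 0) / 2
        + ∑ i, ∑ j, A.C (EuclideanSpace.single 0 (x 0)) i j * a i.succ.succ * b j.succ.succ := by
    intro x hx a b
    have h1 := P.inChart_self t hx (a + b)
    have h2 := P.inChart_self t hx a
    have h3 := P.inChart_self t hx b
    have hs := h.inChart_symm (P.chart t) x a b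
    simp only [map_add, add_apply, PiLp.add_apply] at h1
    have h4 : ∑ i, ∑ j, A.C (EuclideanSpace.single 0 (x 0)) i j
          * (a i.succ.succ + b i.succ.succ) * (a j.succ.succ + b j.succ.succ)
        = ∑ i, ∑ j, A.C (EuclideanSpace.single 0 (x 0)) i j * a i.succ.succ * a j.succ.succ
          + ∑ i, ∑ j, A.C (EuclideanSpace.single 0 (x 0)) i j * b i.succ.succ * b j.succ.succ
          + 2 * ∑ i, ∑ j, A.C (EuclideanSpace.single 0 (x 0)) i j
            * a i.succ.succ * b j.succ.succ := by
      have h5 : ∑ i, ∑ j, A.C (EuclideanSpace.single 0 (x 0)) i j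
            * b i.succ.succ * a j.succ.succ
          = ∑ i, ∑ j, A.C (EuclideanSpace.single 0 (x 0)) i j
            * a i.succ.succ * b j.succ.succ := by
        rw [Finset.sum_comm]
        refine Finset.sum_congr rfl fun i _ ↦ Finset.sum_congr rfl fun j _ ↦ ?_
        have := (hpos _ hx).isHermitian.apply i j
        simp only [star_trivial] at this
        rw [this]
        ring
      rw [two_mul]
      nth_rewrite 2 [← h5]
      simp only [← Finset.sum_add_distrib]
      exact Finset.sum_congr rfl fun i _ ↦ Finset.sum_congr rfl fun j _ ↦ by ring
    rw [h4] at h1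
    linarith
  have htarget : ∀ x : EuclideanSpace ℝ (Fin (m + 2)), x 0 ∈ A.interval →
      x ∈ (P.chart t).target := fun x hx ↦ by rw [P.chart_target]; exact hx
  have hsm := h.contDiffOn_inChart (P.chart_mem t)
  refine ⟨A.interval_isOpen, fun i j ↦ ?_, hpos, fun x hx ↦
    (hsm.contDiffAt ((P.chart t).open_target.mem_nhds (htarget x hx))).differentiableAt (by simp),
    happ⟩
  have hl : ContDiff ℝ ∞ fun u : ℝ ↦ (EuclideanSpace.single 0 u : EuclideanSpace ℝ (Fin (m + 2))) := by
    rw [contDiff_euclidean]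
    intro k
    refine Fin.cases ?_ (fun k ↦ ?_) k
    · simp only [PiLp.single_apply, if_true]
      exact contDiff_id
    · simpa using contDiff_const
  -- Along `γ` the entries of `C` are components of the smooth metric `h`, hence smooth in `u`.
  have h1 : ContDiffOn ℝ ∞ (fun u : ℝ ↦ h.inChart (P.chart t) (EuclideanSpace.single 0 u)
      (EuclideanSpace.single i.succ.succ 1) (EuclideanSpace.single j.succ.succ 1)) A.interval :=
    ((hsm.comp hl.contDiffOn fun u hu ↦ htarget _ (by simpa using hu)).clm_apply
      contDiffOn_const).clm_apply contDiffOn_const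
  refine h1.congr fun u hu ↦ ?_
  rw [happ _ (by simpa using hu)]
  have n0 : ∀ k : Fin m, (0 : Fin (m + 2)) ≠ k.succ.succ := by simp [Fin.ext_iff]
  have n1 : ∀ k : Fin m, (1 : Fin (m + 2)) ≠ k.succ.succ := by simp [Fin.ext_iff]
  simp [n0, n1]

end PenroseMetric

/-! ### The affine function `u`, and extension within one chart. -/

section Completeness

theorem LorentzMetric.IsMaximalNullGeodesic.eq_univ {d : ℕ} {M : Type*} [TopologicalSpace M]
    [ChartedSpace (EuclideanSpace ℝ (Fin d)) M] [IsManifold (𝓡 d) ∞ M]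
    {g : LorentzMetric d M} (hg : g.GeodesicallyComplete) {γ : ℝ → M} {J : Set ℝ}
    (hγ : g.IsMaximalNullGeodesic γ J) : J = univ := by
  obtain ⟨c', hc', heq⟩ := hg J γ hγ.isOpen hγ.ordConnected hγ.geodesic
  exact (hγ.maximal univ c' isOpen_univ ordConnected_univ (subset_univ _) hc' heq).symm

/-- A function with vanishing second derivative on an open interval is affine. -/
theorem exists_affine_of_deriv_deriv_eq_zero {S : Set ℝ} (hS : IsOpen S) (hSc : S.OrdConnected)
    {U : ℝ → ℝ} (hU : ∀ s ∈ S, DifferentiableAt ℝ U s) (hU' : ∀ s ∈ S, HasDerivAt (deriv U) 0 s) :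
    ∃ a b : ℝ, ∀ s ∈ S, U s = a * s + b := by
  obtain ⟨a, ha⟩ := hS.exists_is_const_of_deriv_eq_zero hSc.isPreconnected
    (fun s hs ↦ (hU' s hs).differentiableAt.differentiableWithinAt) (fun s hs ↦ (hU' s hs).deriv)
  have hd : ∀ s ∈ S, HasDerivAt (fun s ↦ U s - a * s) 0 s := by
    intro s hs
    refine ((hU s hs).hasDerivAt.sub ((hasDerivAt_id s).const_mul a)).congr_deriv ?_
    simp [ha s hs]
  obtain ⟨b, hb⟩ := hS.exists_is_const_of_deriv_eq_zero hSc.isPreconnected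
    (fun s hs ↦ (hd s hs).differentiableAt.differentiableWithinAt) (fun s hs ↦ (hd s hs).deriv)
  exact ⟨a, b, fun s hs ↦ by have := hb s hs; linarith⟩

variable {m : ℕ} {M : Type*} [TopologicalSpace M]
  [ChartedSpace (EuclideanSpace ℝ (Fin (m + 2))) M] [IsManifold (𝓡 (m + 2)) ∞ M]
  {g : LorentzMetric (m + 2) M} {γ : ℝ → M} {J : Set ℝ}
  {N : Type*} [TopologicalSpace N] [ChartedSpace (EuclideanSpace ℝ (Fin (m + 2))) N]
  [IsManifold (𝓡 (m + 2)) ∞ N] {h : LorentzMetric (m + 2) N}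

theorem PenroseLimit.mem_source (P : PenroseLimit g γ J h) (t : J) {p : N} :
    p ∈ (P.chart t).source ↔ P.u p ∈ (P.adapted t).interval := by
  rw [P.chart_source]; rfl

theorem PenroseLimit.mem_target (P : PenroseLimit g γ J h) (t : J)
    {x : EuclideanSpace ℝ (Fin (m + 2))} :
    x ∈ (P.chart t).target ↔ x 0 ∈ (P.adapted t).interval := by
  rw [P.chart_target]; rfl

/-- The function `u` is affine along geodesics. -/
theorem PenroseLimit.exists_u_affine (P : PenroseLimit g γ J h) {c : ℝ → N} {S : Set ℝ}
    (hS : IsOpen S) (hSc : S.OrdConnected) (hc : h.IsGeodesicOn c S) :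
    ∃ a b : ℝ, ∀ s ∈ S, P.u (c s) = a * s + b := by
  have key : ∀ s ∈ S, HasDerivAt (fun s ↦ P.u (c s)) (deriv (fun s ↦ P.u (c s)) s) s ∧
      HasDerivAt (deriv fun s ↦ P.u (c s)) 0 s := by
    intro s hs
    -- The chart varies with `s`, but its first coordinate is always the global `u`, so `u'' = 0`
    -- holds on all of `S`.
    let t : J := ⟨P.u (c s), P.u_mem _⟩
    have hsrc : c s ∈ (P.chart t).source := (P.mem_source t).2 (P.mem_interval t)
    have hct := hc.1.contMDiffAt (hS.mem_nhds hs)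
    have hx := contDiffAt_chart_comp (P.chart_mem t) hct hsrc
    have hev : (fun s ↦ P.u (c s)) =ᶠ[𝓝 s] fun s ↦ (P.chart t ∘ c) s 0 := by
      filter_upwards [hct.continuousAt.eventually ((P.chart t).open_source.mem_nhds hsrc)] with r hr
      exact (P.chart_u t _ hr).symm
    have hx1 : ∀ᶠ r in 𝓝 s, DifferentiableAt ℝ (P.chart t ∘ c) r :=
      ((hx.of_le (m := 1) ENat.LEInfty.out).eventually (by simp)).mono
        fun r hr ↦ hr.differentiableAt (by simp)
    have hx2 : HasDerivAt (deriv (P.chart t ∘ c)) (deriv (deriv (P.chart t ∘ c)) s) s :=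
      ((hx.derivWithin (m := ∞) le_rfl).differentiableAt (by simp)).hasDerivAt
    have hev' : deriv (fun s ↦ P.u (c s)) =ᶠ[𝓝 s] fun s ↦ deriv (P.chart t ∘ c) s 0 :=
      hev.deriv.trans (hx1.mono fun r hr ↦ (hasDerivAt_coord hr.hasDerivAt 0).deriv)
    have h0 := (((P.isRosenMetric t).geodesicDefect_eq_zero_iff (x := P.chart t ∘ c) (t := s)
      (by rw [← P.mem_target]; exact (P.chart t).map_source hsrc)).1
      (((h.isGeodesicOn_iff _ _).1 hc).2 _ (P.chart_mem t) s hs hsrc)).1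
    refine ⟨?_, ?_⟩
    · exact (((hasDerivAt_coord hx1.self_of_nhds.hasDerivAt 0).congr_of_eventuallyEq
        hev).differentiableAt).hasDerivAt
    · rw [← h0]
      exact (hasDerivAt_coord hx2 0).congr_of_eventuallyEq hev'
  exact exists_affine_of_deriv_deriv_eq_zero hS hSc (fun s hs ↦ (key s hs).1.differentiableAt)
    fun s hs ↦ (key s hs).2

/-- A geodesic extends over all parameters that one chart of the Penrose limit can account for. -/
theorem PenroseLimit.exists_extension_in_chart (P : PenroseLimit g γ J h) (t : J) {S S' : Set ℝ}
    (hS : IsOpen S) (hSc : S.OrdConnected) (hS' : IsOpen S') (hSc' : S'.OrdConnected)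
    (hne : S'.Nonempty) (hsub : S' ⊆ S) {a b : ℝ}
    (hI : ∀ s ∈ S, a * s + b ∈ (P.adapted t).interval) {c : ℝ → N} (hc : h.IsGeodesicOn c S')
    (hu : ∀ s ∈ S', P.u (c s) = a * s + b) :
    ∃ c' : ℝ → N, h.IsGeodesicOn c' S ∧ EqOn c' c S' ∧ ∀ s ∈ S, P.u (c' s) = a * s + b := by
  have hsrc : ∀ s ∈ S', c s ∈ (P.chart t).source := fun s hs ↦
    (P.mem_source t).2 (hu s hs ▸ hI s (hsub hs))
  have hx : ContDiffOn ℝ ∞ (P.chart t ∘ c) S' := fun s hs ↦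
    (contDiffAt_chart_comp (P.chart_mem t) (hc.1.contMDiffAt (hS'.mem_nhds hs))
      (hsrc s hs)).contDiffWithinAt
  obtain ⟨x', hx'c, hx'e, hx'0, hx'd⟩ := (P.isRosenMetric t).exists_extension hS hSc hS' hSc' hne
    hsub hI hx (fun s hs ↦ (P.chart_u t _ (hsrc s hs)).trans (hu s hs))
    (fun s hs ↦ ((h.isGeodesicOn_iff _ _).1 hc).2 _ (P.chart_mem t) s hs (hsrc s hs))
  have htgt : ∀ s ∈ S, x' s ∈ (P.chart t).target := fun s hs ↦
    (P.mem_target t).2 (hx'0 s hs ▸ hI s hs)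
  refine ⟨(P.chart t).symm ∘ x', h.isGeodesicOn_of_chart hS ?_ fun s hs ↦
    ⟨P.chart t, P.chart_mem t, (P.chart t).map_target (htgt s hs), fun w ↦ ?_⟩, ?_, ?_⟩
  · exact (contMDiffOn_symm_of_mem_maximalAtlas (P.chart_mem t)).comp
      (contMDiffOn_iff_contDiffOn.2 hx'c) htgt
  · rw [← hx'd s hs w]
    refine geodesicDefect_congr (Filter.eventuallyEq_of_mem (hS.mem_nhds hs) fun r hr ↦ ?_) w
    exact (P.chart t).right_inv (htgt r hr)
  · intro s hs
    simp only [Function.comp_apply]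
    rw [hx'e hs]
    exact (P.chart t).left_inv (hsrc s hs)
  · intro s hs
    simp only [Function.comp_apply]
    rw [← hx'0 s hs, ← P.chart_u t _ ((P.chart t).map_target (htgt s hs)),
      (P.chart t).right_inv (htgt s hs)]

end Completeness

/-! ### From local extension to extension over the real line. -/

section Gluing

/-- If local solutions of a problem on intervals of `ℝ` are stable under gluing, and each of them
extends across any boundary point of its domain, then each of them extends to `ℝ`. -/
theorem exists_extension_univ {N : Type*} (Q : Set ℝ → (ℝ → N) → Prop)
    (hloc : ∀ (S : Set ℝ) (c : ℝ → N),
      (∀ t ∈ S, ∃ V, IsOpen V ∧ t ∈ V ∧ ∃ c₁, Q V c₁ ∧ EqOn c c₁ V) → Q S c)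
    (hext : ∀ (S : Set ℝ) (c : ℝ → N), IsOpen S → S.OrdConnected → S.Nonempty → Q S c →
      ∀ t, t ∈ closure S → ∃ V, IsOpen V ∧ V.OrdConnected ∧ t ∈ V ∧
        ∃ c₁, Q V c₁ ∧ EqOn c₁ c (S ∩ V))
    {S₀ : Set ℝ} {c₀ : ℝ → N} (hS₀ : IsOpen S₀) (hS₀c : S₀.OrdConnected) (hne : S₀.Nonempty)
    (hc₀ : Q S₀ c₀) : ∃ c, Q univ c ∧ EqOn c c₀ S₀ := by
  classical
  let X := {p : Set ℝ × (ℝ → N) // IsOpen p.1 ∧ p.1.OrdConnected ∧ S₀ ⊆ p.1 ∧ Q p.1 p.2 ∧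
    EqOn p.2 c₀ S₀}
  -- Only a preorder, since values off the domain are arbitrary; transitivity suffices for Zorn's
  -- lemma.
  let r : X → X → Prop := fun p q ↦ p.1.1 ⊆ q.1.1 ∧ EqOn q.1.2 p.1.2 p.1.1
  have hchain : ∀ K : Set X, IsChain r K → ∃ ub, ∀ p ∈ K, r p ub := by
    intro K hK
    rcases K.eq_empty_or_nonempty with rfl | ⟨p₀, hp₀⟩
    · exact ⟨⟨(S₀, c₀), hS₀, hS₀c, subset_rfl, hc₀, fun _ _ ↦ rfl⟩, by simp⟩
    have hagree : ∀ p ∈ K, ∀ q ∈ K, ∀ s, s ∈ p.1.1 → s ∈ q.1.1 → p.1.2 s = q.1.2 s := by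
      intro p hp q hq s hsp hsq
      rcases eq_or_ne p q with rfl | hne
      · rfl
      rcases hK hp hq hne with hr | hr
      · exact (hr.2 hsp).symm
      · exact hr.2 hsq
    let T : Set ℝ := ⋃ p ∈ K, p.1.1
    let c : ℝ → N := fun s ↦ if hs : ∃ p ∈ K, s ∈ p.1.1 then hs.choose.1.2 s else c₀ s
    have hc : ∀ p ∈ K, EqOn c p.1.2 p.1.1 := by
      intro p hp s hs
      have hex : ∃ p ∈ K, s ∈ p.1.1 := ⟨p, hp, hs⟩
      simp only [c, dif_pos hex]
      exact hagree _ hex.choose_spec.1 _ hp _ hex.choose_spec.2 hs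
    have hsub : ∀ p ∈ K, p.1.1 ⊆ T := fun p hp ↦ subset_biUnion_of_mem (u := fun p : X ↦ p.1.1) hp
    refine ⟨⟨(T, c), isOpen_biUnion fun p _ ↦ p.2.1, ?_, p₀.2.2.2.1.trans (hsub _ hp₀), ?_, ?_⟩,
      fun p hp ↦ ⟨hsub p hp, hc p hp⟩⟩
    · obtain ⟨s₀, hs₀⟩ := hne
      refine IsPreconnected.ordConnected (isPreconnected_of_forall s₀ fun s hs ↦ ?_)
      obtain ⟨p, hp, hsp⟩ := mem_iUnion₂.1 hs
      exact ⟨p.1.1, hsub p hp, p.2.2.2.1 hs₀, hsp, p.2.2.1.isPreconnected⟩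
    · refine hloc _ _ fun t ht ↦ ?_
      obtain ⟨p, hp, htp⟩ := mem_iUnion₂.1 ht
      exact ⟨p.1.1, p.2.1, htp, p.1.2, p.2.2.2.2.1, hc p hp⟩
    · intro s hs
      exact (hc p₀ hp₀ (p₀.2.2.2.1 hs)).trans (p₀.2.2.2.2.2 hs)
  obtain ⟨⟨⟨S, c⟩, hS, hSc, hsub, hQ, heq⟩, hmax⟩ := exists_maximal_of_chains_bounded hchain
    fun {p q s} (h₁ : r p q) (h₂ : r q s) ↦
      ⟨h₁.1.trans h₂.1, fun x hx ↦ (h₂.2 (h₁.1 hx)).trans (h₁.2 hx)⟩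
  simp only at hS hSc hsub hQ heq
  have hSne : S.Nonempty := hne.mono hsub
  -- A maximal domain contains its boundary points: otherwise gluing on `V` would enlarge it. Being
  -- also open and non-empty, it is all of `ℝ`.
  have hcl : closure S ⊆ S := by
    intro t ht
    obtain ⟨V, hV, hVc, htV, c₁, hc₁, he⟩ := hext S c hS hSc hSne hQ t ht
    obtain ⟨z, hzV, hzS⟩ := mem_closure_iff.1 ht V hV htV
    let c₂ : ℝ → N := fun s ↦ if s ∈ V then c₁ s else c s
    have h₁ : EqOn c₂ c₁ V := fun s hs ↦ by simp [c₂, hs]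
    have h₂ : EqOn c₂ c S := fun s hs ↦ by
      by_cases hsV : s ∈ V
      · rw [h₁ hsV, he ⟨hs, hsV⟩]
      · simp [c₂, hsV]
    have hQ₂ : Q (S ∪ V) c₂ := hloc _ _ fun s hs ↦ hs.elim
      (fun hs ↦ ⟨S, hS, hs, c, hQ, h₂⟩) fun hs ↦ ⟨V, hV, hs, c₁, hc₁, h₁⟩
    have hconn : (S ∪ V).OrdConnected :=
      (IsPreconnected.union z hzS hzV hSc.isPreconnected hVc.isPreconnected).ordConnected
    have := hmax ⟨(S ∪ V, c₂), hS.union hV, hconn, hsub.trans subset_union_left, hQ₂,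
      (h₂.mono hsub).trans heq⟩ ⟨subset_union_left, h₂⟩
    exact this.1 (Or.inr htV)
  have hSu : S = univ :=
    IsClopen.eq_univ ⟨isClosed_of_closure_subset hcl, hS⟩ hSne
  exact ⟨c, hSu ▸ hQ, heq⟩

end Gluing

/-- The Penrose limit of a geodesically complete Lorentzian manifold along any (inextendible) null
geodesic is geodesically complete. -/
theorem mainTheorem10 {m : ℕ}
    {M : Type*} [TopologicalSpace M] [T2Space M] [SecondCountableTopology M]
    [ChartedSpace (EuclideanSpace ℝ (Fin (m + 2))) M] [IsManifold (𝓡 (m + 2)) ∞ M]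
    (g : LorentzMetric (m + 2) M) (hg : g.GeodesicallyComplete)
    (γ : ℝ → M) (J : Set ℝ) (hγ : g.IsMaximalNullGeodesic γ J)
    {N : Type*} [TopologicalSpace N] [T2Space N] [SecondCountableTopology N]
    [ChartedSpace (EuclideanSpace ℝ (Fin (m + 2))) N] [IsManifold (𝓡 (m + 2)) ∞ N]
    (h : LorentzMetric (m + 2) N) (P : PenroseLimit g γ J h) :
    h.GeodesicallyComplete := by
  obtain rfl : J = univ := hγ.eq_univ hg
  intro S₀ c₀ hS₀ hS₀c hc₀
  rcases S₀.eq_empty_or_nonempty with rfl | hne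
  -- The value `c₀ 0` serves merely as some point of `N`.
  · exact ⟨fun _ ↦ c₀ 0, h.isGeodesicOn_const _ _, eqOn_empty _ _⟩
  obtain ⟨a, b, hab⟩ := P.exists_u_affine hS₀ hS₀c hc₀
  obtain ⟨c, hc, hcc₀⟩ := exists_extension_univ
    -- Keeping `a` and `b` in the property predicts the value of `u` at an endpoint, where the curve
    -- itself may be undefined.
    (fun S c ↦ h.IsGeodesicOn c S ∧ ∀ s ∈ S, P.u (c s) = a * s + b)
    (fun S c hloc ↦ ⟨LorentzMetric.isGeodesicOn_of_locally fun t ht ↦ by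
        obtain ⟨V, hV, htV, c₁, hc₁, he⟩ := hloc t ht
        exact ⟨V, hV, htV, c₁, hc₁.1, he⟩, fun t ht ↦ by
        obtain ⟨V, hV, htV, c₁, hc₁, he⟩ := hloc t ht
        rw [he htV, hc₁.2 t htV]⟩)
    (fun S c hS hSc hSne hc t ht ↦ by
      -- Here `J = ℝ` is essential: there is an adapted chart at the predicted value.
      let t' : (univ : Set ℝ) := ⟨a * t + b, mem_univ _⟩
      let V : Set ℝ := (fun s ↦ a * s + b) ⁻¹' (P.adapted t').interval
      have hV : IsOpen V := (P.adapted t').interval_isOpen.preimage (by fun_prop)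
      have htV : t ∈ V := P.mem_interval t'
      have hVc : V.OrdConnected := by
        rcases le_total 0 a with ha | ha
        · exact (P.adapted t').interval_ordConnected.preimage_mono fun x y hxy ↦ by
            have := mul_le_mul_of_nonneg_left hxy ha
            simpa using this
        · exact (P.adapted t').interval_ordConnected.preimage_anti fun x y hxy ↦ by
            have := mul_le_mul_of_nonpos_left hxy ha
            simpa using this
      -- The overlap `S ∩ V` is a non-empty open interval, on which `c` supplies the initial data
      -- for the extension to `V`.
      obtain ⟨z, hzV, hzS⟩ := mem_closure_iff.1 ht V hV htV
      obtain ⟨c', hc', he, hu⟩ := P.exists_extension_in_chart t' hV hVc (hS.inter hV)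
        (hSc.inter hVc) ⟨z, hzS, hzV⟩ inter_subset_right (fun s hs ↦ hs)
        (hc.1.mono inter_subset_left) fun s hs ↦ hc.2 s hs.1
      exact ⟨V, hV, hVc, htV, c', ⟨hc', hu⟩, he⟩)
    hS₀ hS₀c hne ⟨hc₀, hab⟩
  exact ⟨c, hc.1, hcc₀⟩
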